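/- Fix a countably infinite set of propositional variables. Modal formulas are built from literals (variables $p$ and negated variables $\neg p$) and the constants $\bot,\top$ by $\wedge,\vee,\Diamond,\Box$; the negation of a formula is defined by the duality laws, and $\varphi\to\psi$ abbreviates $\neg\varphi\vee\psi$. Write $\mathrm{lits}(\varphi)$ and $\mathrm{vars}(\varphi)$ for the sets of literals and of variables occurring in $\varphi$. A modal logic is a set of formulas that contains all classical tautologies and is closed under modus ponens, substitution and the rule $\frac{\varphi\leftrightarrow\psi}{\Diamond\varphi\leftrightarrow\Diamond\psi}$. It is monotone if it contains $\Diamond p\to\Diamond(p\vee q)$, and normal if it is monotone and also contains $\Box\top$ and $\Diamond(p\vee q)\to\Diamond p\vee\Diamond q$. $\mathrm{S4}$ is the least normal logic containing $p\to\Diamond p$ and $\Diamond\Diamond p\to\Diamond p$. The logic $\mathrm{Log}\,\mathcal F$ of a Kripke frame $\mathcal F$ is the set of formulas true at all worlds of $\mathcal F$ under all valuations. A normal logic is tabular if it is $\mathrm{Log}\,\mathcal F$ for some finite Kripke frame $\mathcal F$. Let $\Lambda$ be a monotone logic, and let $\vec p$, $\bar r$ be disjoint finite tuples of variables. A formula $\varphi(\vec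 p,\bar r)$ (with all its variables among $\vec p,\bar r$) is $\vec p$-positive if no variable of $\vec p$ occurs negated in it, and $\vec p$-monotone in $\Lambda$ if $\varphi(\vec p,\bar r)\to\varphi(\vec p\vee\vec q,\bar r)\in\Lambda$, where $\vec q$ is a tuple of fresh variables of the same length as $\vec p$. $\Lambda$ has the Lyndon positivity property (LPP) if, for all such $\vec p,\bar r$, every formula $\varphi(\vec p,\bar r)$ that is $\vec p$-monotone in $\Lambda$ is $\Lambda$-equivalent to some $\vec p$-positive formula $\alpha(\vec p,\bar r)$. A logic $\Lambda$ has the Craig (respectively Lyndon) interpolation property, CIP (LIP), if whenever $\varphi\to\psi\in\Lambda$ there is a formula $\iota$ with $\varphi\to\iota\in\Lambda$, $\iota\to\psi\in\Lambda$ and $\mathrm{vars}(\iota)\subseteq\mathrm{vars}(\varphi)\cap\mathrm{vars}(\psi)$ (respectively $\mathrm{lits}(\iota)\subseteq\mathrm{lits}(\varphi)\cap\mathrm{lits}(\psi)$). For $k\ge 1$ let $\mathcal D_k$ be the Kripke frame with worlds $0,1,\dots,k$ in which $i$ sees $j$ if and only if $i,j<k$ or $i=k$ (a $k$-element cluster with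 an extra root $k$ that sees all worlds, including itself). **Proposition.** For every integer $k\ge 1$, $\mathrm{Log}\,\mathcal D_k$ is a tabular logic that contains $\mathrm{S4}$ and has LPP. Moreover, there are infinitely many tabular logics containing $\mathrm{S4}$ that have neither CIP nor LIP but have LPP. -/

import Mathlib

/-- Propositional variables: a fixed countably infinite set. -/
abbrev PVar : Type := ℕ

/-- A literal is a variable or the negation of a variable. -/
inductive Literal : Type
  | pos : PVar → Literal
  | neg : PVar → Literal

/-- The complementary literal. -/
def Literal.compl : Literal → Literal
  | .pos p => .neg p
  | .neg p => .pos p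

/-- Modal formulas, built from literals and the constants by `∧`, `∨`, `◇`, `□`. -/
inductive Fm : Type
  | lit : Literal → Fm
  | bot : Fm
  | top : Fm
  | and : Fm → Fm → Fm
  | or : Fm → Fm → Fm
  | dia : Fm → Fm
  | box : Fm → Fm

namespace Fm

/-- The formula consisting of the variable `p`. -/
def var (p : PVar) : Fm := lit (.pos p)

/-- Negation of a formula, defined by the duality laws. -/
def neg : Fm → Fm
  | lit l => lit l.compl
  | bot => top
  | top => bot
  | and φ ψ => or φ.neg ψ.neg
  | or φ ψ => and φ.neg ψ.neg
  | dia φ => box φ.neg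
  | box φ => dia φ.neg

/-- Implication. -/
def imp (φ ψ : Fm) : Fm := or φ.neg ψ

/-- Bi-implication. -/
def iff (φ ψ : Fm) : Fm := and (imp φ ψ) (imp ψ φ)

/-- The set of literals that occur in a formula. -/
def lits : Fm → Set Literal
  | lit l => {l}
  | bot => ∅
  | top => ∅
  | and φ ψ => φ.lits ∪ ψ.lits
  | or φ ψ => φ.lits ∪ ψ.lits
  | dia φ => φ.lits
  | box φ => φ.lits

/-- The set of variables that occur in a formula, negated or not. -/
def vars (φ : Fm) : Set PVar := {p | Literal.pos p ∈ φ.lits ∨ Literal.neg p ∈ φ.lits}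

/-- Simultaneous substitution of formulas for variables (negations are expanded). -/
def subst (σ : PVar → Fm) : Fm → Fm
  | lit (.pos p) => σ p
  | lit (.neg p) => (σ p).neg
  | bot => bot
  | top => top
  | and φ ψ => and (φ.subst σ) (ψ.subst σ)
  | or φ ψ => or (φ.subst σ) (ψ.subst σ)
  | dia φ => dia (φ.subst σ)
  | box φ => box (φ.subst σ)

/-- Classical tautologies of the modal language: formulas that are true under every classical
truth assignment to all formulas. The assignment respects the Boolean connectives, negation
included, and is otherwise arbitrary on formulas that begin with a modality. -/
def IsTautology (φ : Fm) : Prop :=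
  ∀ e : Fm → Prop, ¬ e bot → e top →
    (∀ α β, e (and α β) ↔ (e α ∧ e β)) → (∀ α β, e (or α β) ↔ (e α ∨ e β)) →
    (∀ α, e α.neg ↔ ¬ e α) → e φ

/-- `◇p → ◇(p ∨ q)`. -/
def AM : Fm := imp (dia (var 0)) (dia (or (var 0) (var 1)))

/-- `◇(p ∨ q) → ◇p ∨ ◇q`. -/
def AC : Fm := imp (dia (or (var 0) (var 1))) (or (dia (var 0)) (dia (var 1)))

/-- `□⊤`. -/
def AN : Fm := box top

/-- `p → ◇p`. -/
def AT : Fm := imp (var 0) (dia (var 0))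

/-- `◇◇p → ◇p`. -/
def A4 : Fm := imp (dia (dia (var 0))) (dia (var 0))

end Fm

open Fm in
/-- A modal logic: a set of formulas that contains all classical tautologies and is closed under
modus ponens, substitution and equivalent replacement. -/
structure IsModalLogic (Λ : Set Fm) : Prop where
  taut : ∀ φ, IsTautology φ → φ ∈ Λ
  mp : ∀ φ ψ, imp φ ψ ∈ Λ → φ ∈ Λ → ψ ∈ Λ
  subst : ∀ φ (σ : PVar → Fm), φ ∈ Λ → φ.subst σ ∈ Λ
  repl : ∀ φ ψ, iff φ ψ ∈ Λ → iff (dia φ) (dia ψ) ∈ Λ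

/-- The smallest modal logic that contains `Γ`. -/
def leastLogic (Γ : Set Fm) : Set Fm := {φ | ∀ Λ, IsModalLogic Λ → Γ ⊆ Λ → φ ∈ Λ}

/-- The smallest monotone logic `EM`. -/
def logicEM : Set Fm := leastLogic {Fm.AM}

/-- The smallest normal logic `K`. -/
def logicK : Set Fm := leastLogic {Fm.AM, Fm.AN, Fm.AC}

/-- The logic `S4`. -/
def logicS4 : Set Fm := leastLogic {Fm.AM, Fm.AN, Fm.AC, Fm.AT, Fm.A4}

/-- A monotone logic is a modal logic containing `EM`. -/
def IsMonotoneLogic (Λ : Set Fm) : Prop := IsModalLogic Λ ∧ logicEM ⊆ Λ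

/-- A normal logic is a modal logic containing `K`. -/
def IsNormalLogic (Λ : Set Fm) : Prop := IsModalLogic Λ ∧ logicK ⊆ Λ

/-- A Kripke frame: a set of worlds with an accessibility relation. -/
structure KripkeFrame : Type 1 where
  World : Type
  rel : World → World → Prop

namespace KripkeFrame

/-- The set of worlds at which a formula is true under the valuation `θ`. -/
def eval (F : KripkeFrame) (θ : PVar → Set F.World) : Fm → Set F.World
  | .lit (.pos p) => θ p
  | .lit (.neg p) => (θ p)ᶜ
  | .bot => ∅
  | .top => Set.univ
  | .and φ ψ => F.eval θ φ ∩ F.eval θ ψ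
  | .or φ ψ => F.eval θ φ ∪ F.eval θ ψ
  | .dia φ => {w | ∃ v, F.rel w v ∧ v ∈ F.eval θ φ}
  | .box φ => {w | ∀ v, F.rel w v → v ∈ F.eval θ φ}

/-- The logic of a frame: all formulas true at all worlds under all valuations. -/
def Log (F : KripkeFrame) : Set Fm := {φ | ∀ θ : PVar → Set F.World, F.eval θ φ = Set.univ}

/-- The frame `D_k`: the worlds `0, …, k - 1` form a cluster, and the world `k` sees
all worlds. -/
def D (k : ℕ) : KripkeFrame where
  World := Fin (k + 1)
  rel i j := (i.val < k ∧ j.val < k) ∨ i.val = k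

end KripkeFrame

/-- A tabular logic: a normal logic that is the logic of a finite Kripke frame. -/
def IsTabular (Λ : Set Fm) : Prop :=
  IsNormalLogic Λ ∧ ∃ F : KripkeFrame, Finite F.World ∧ Λ = F.Log

/-- The formula `φ` is `P`-positive: no variable from `P` occurs negated. -/
def IsPositiveIn (P : Finset PVar) (φ : Fm) : Prop := ∀ p ∈ P, Literal.neg p ∉ φ.lits

/-- The formula `φ(P, R)` is `P`-monotone in `Λ`: the formula `φ(P, R) → φ(P ∨ Q, R)` is in `Λ`,
where `Q` is a tuple of fresh, pairwise different variables `q p`, one for each `p ∈ P`.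
(For a modal logic `Λ` the choice of `Q` is irrelevant.) -/
def IsMonotoneIn (Λ : Set Fm) (P R : Finset PVar) (φ : Fm) : Prop :=
  ∃ q : PVar → PVar, Set.InjOn q P ∧ (∀ p ∈ P, q p ∉ P ∪ R) ∧
    Fm.imp φ (φ.subst fun v => if v ∈ P then Fm.or (Fm.var v) (Fm.var (q v)) else Fm.var v) ∈ Λ

/-- The Lyndon positivity property of a monotone logic `Λ`: every formula `φ(P, R)` that is
`P`-monotone in `Λ` is `Λ`-equivalent to some `P`-positive formula `α(P, R)`. -/
def HasLPP (Λ : Set Fm) : Prop :=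
  IsMonotoneLogic Λ ∧
    ∀ (P R : Finset PVar), Disjoint P R → ∀ φ : Fm, φ.vars ⊆ ↑(P ∪ R) → IsMonotoneIn Λ P R φ →
      ∃ α : Fm, α.vars ⊆ ↑(P ∪ R) ∧ IsPositiveIn P α ∧ Fm.iff φ α ∈ Λ

/-- The Craig interpolation property. -/
def HasCIP (Λ : Set Fm) : Prop :=
  ∀ φ ψ : Fm, Fm.imp φ ψ ∈ Λ →
    ∃ ι : Fm, ι.vars ⊆ φ.vars ∩ ψ.vars ∧ Fm.imp φ ι ∈ Λ ∧ Fm.imp ι ψ ∈ Λ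

/-- The Lyndon interpolation property. -/
def HasLIP (Λ : Set Fm) : Prop :=
  ∀ φ ψ : Fm, Fm.imp φ ψ ∈ Λ →
    ∃ ι : Fm, ι.lits ⊆ φ.lits ∩ ψ.lits ∧ Fm.imp φ ι ∈ Λ ∧ Fm.imp ι ψ ∈ Λ

/-! Every world of `D k` sees exactly the cluster and itself, so truth at a point depends only on
its type (the variables true there) and on the set of types realized in the cluster (`sat_congr`).

LPP: a `P`-monotone formula survives raising the types world by world (`IsMonotoneIn.sat_mono`). A
positive normal form needs more: preservation whenever the point's type grows and the two sets of
cluster types are related in the Egli–Milner sense, each type of either cluster being comparable, in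
the right direction, to one of the other. `exists_rearrangement` reduces this to the pointwise case:
raise, re-index without changing the set of values, raise again. All this uses the same index set,
so the model never leaves `D k`. The formula is then equivalent to the disjunction of the positive
descriptions `modelFm` of its finitely many models up to types (`hasLPP_Log_D`).

Failure of CIP: auxiliary variables can force many distinct cluster worlds. For `k ≥ 3` there cannot
be `k - 1` cluster worlds where a variable holds and `k - 1` where it fails, but a formula in that
variable alone cannot count and so cannot interpolate. The same counting separates the logics for
different `k`. -/

/-! ### Soundness: frame logics are normal, and those of `D k` contain S4. -/

theorem KripkeFrame.eval_neg (F : KripkeFrame) (θ : PVar → Set F.World) (φ : Fm) :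
    F.eval θ φ.neg = (F.eval θ φ)ᶜ := by
  induction φ with
  | lit l => cases l <;> simp [Fm.neg, Literal.compl, eval]
  | bot => simp [Fm.neg, eval]
  | top => simp [Fm.neg, eval]
  | and φ ψ h1 h2 => simp [Fm.neg, eval, h1, h2, Set.compl_inter]
  | or φ ψ h1 h2 => simp [Fm.neg, eval, h1, h2, Set.compl_union]
  | dia φ h => ext w; simp [Fm.neg, eval, h]
  | box φ h => ext w; simp [Fm.neg, eval, h]

theorem KripkeFrame.eval_subst (F : KripkeFrame) (θ : PVar → Set F.World) (σ : PVar → Fm)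
    (φ : Fm) : F.eval θ (φ.subst σ) = F.eval (fun p => F.eval θ (σ p)) φ := by
  induction φ with
  | lit l => cases l <;> simp [Fm.subst, eval, eval_neg]
  | bot => rfl
  | top => rfl
  | and φ ψ h1 h2 => simp [Fm.subst, eval, h1, h2]
  | or φ ψ h1 h2 => simp [Fm.subst, eval, h1, h2]
  | dia φ h => simp [Fm.subst, eval, h]
  | box φ h => simp [Fm.subst, eval, h]

theorem KripkeFrame.mem_eval_imp {F : KripkeFrame} {θ : PVar → Set F.World} {φ ψ : Fm}
    {w : F.World} : w ∈ F.eval θ (Fm.imp φ ψ) ↔ (w ∈ F.eval θ φ → w ∈ F.eval θ ψ) := by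
  simp only [Fm.imp, eval, eval_neg, Set.mem_union, Set.mem_compl_iff]
  tauto

theorem KripkeFrame.mem_eval_iff {F : KripkeFrame} {θ : PVar → Set F.World} {φ ψ : Fm}
    {w : F.World} : w ∈ F.eval θ (Fm.iff φ ψ) ↔ (w ∈ F.eval θ φ ↔ w ∈ F.eval θ ψ) := by
  rw [Fm.iff, eval, Set.mem_inter_iff, mem_eval_imp, mem_eval_imp]
  exact iff_def.symm

theorem KripkeFrame.mem_Log {F : KripkeFrame} {φ : Fm} :
    φ ∈ F.Log ↔ ∀ (θ : PVar → Set F.World) (w : F.World), w ∈ F.eval θ φ := by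
  simp only [Log, Set.mem_ofPred_eq, Set.eq_univ_iff_forall]

theorem KripkeFrame.isModalLogic_Log (F : KripkeFrame) : IsModalLogic F.Log where
  taut φ h := mem_Log.2 fun θ w => h (fun ψ => w ∈ F.eval θ ψ) (by simp [eval]) (by simp [eval])
    (fun _ _ => Iff.rfl) (fun _ _ => Iff.rfl) (fun α => by simp [eval_neg])
  mp φ ψ h1 h2 := mem_Log.2 fun θ w => mem_eval_imp.1 (mem_Log.1 h1 θ w) (mem_Log.1 h2 θ w)
  subst φ σ h := mem_Log.2 fun θ w => by
    rw [eval_subst]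
    exact mem_Log.1 h _ w
  repl φ ψ h := mem_Log.2 fun θ w => by
    have h' : ∀ v, v ∈ F.eval θ φ ↔ v ∈ F.eval θ ψ := fun v => mem_eval_iff.1 (mem_Log.1 h θ v)
    rw [mem_eval_iff]
    simp only [eval, h']

theorem KripkeFrame.AM_mem_Log (F : KripkeFrame) : Fm.AM ∈ F.Log := mem_Log.2 fun θ w => by
  rw [Fm.AM, mem_eval_imp]
  rintro ⟨v, h, hv⟩
  exact ⟨v, h, Or.inl hv⟩

theorem KripkeFrame.AN_mem_Log (F : KripkeFrame) : Fm.AN ∈ F.Log :=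
  mem_Log.2 fun _ _ _ _ => trivial

theorem KripkeFrame.AC_mem_Log (F : KripkeFrame) : Fm.AC ∈ F.Log := mem_Log.2 fun θ w => by
  rw [Fm.AC, mem_eval_imp]
  rintro ⟨v, h, hv | hv⟩
  · exact Or.inl ⟨v, h, hv⟩
  · exact Or.inr ⟨v, h, hv⟩

theorem KripkeFrame.isNormalLogic_Log (F : KripkeFrame) : IsNormalLogic F.Log := by
  refine ⟨F.isModalLogic_Log, fun φ h => h _ F.isModalLogic_Log ?_⟩
  rintro ψ (rfl | rfl | rfl)
  exacts [F.AM_mem_Log, F.AN_mem_Log, F.AC_mem_Log]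

theorem KripkeFrame.isMonotoneLogic_Log (F : KripkeFrame) : IsMonotoneLogic F.Log := by
  refine ⟨F.isModalLogic_Log, fun φ h => h _ F.isModalLogic_Log ?_⟩
  rintro ψ rfl
  exact F.AM_mem_Log

theorem KripkeFrame.logicS4_subset_Log (F : KripkeFrame) (hr : ∀ w, F.rel w w)
    (ht : ∀ u v w, F.rel u v → F.rel v w → F.rel u w) : logicS4 ⊆ F.Log := by
  refine fun φ h => h _ F.isModalLogic_Log ?_
  rintro ψ (rfl | rfl | rfl | rfl | rfl)
  · exact F.AM_mem_Log
  · exact F.AN_mem_Log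
  · exact F.AC_mem_Log
  · refine mem_Log.2 fun θ w => mem_eval_imp.2 fun h => ⟨w, hr w, h⟩
  · refine mem_Log.2 fun θ w => mem_eval_imp.2 ?_
    rintro ⟨v, hv, u, hu, h⟩
    exact ⟨u, ht _ _ _ hv hu, h⟩

theorem KripkeFrame.D_rel_iff {k : ℕ} {i j : Fin (k + 1)} :
    (D k).rel i j ↔ j.val < k ∨ j = i := by
  have hi := i.isLt
  have hj := j.isLt
  simp only [D, Fin.ext_iff]
  omega

theorem KripkeFrame.logicS4_subset_Log_D (k : ℕ) : logicS4 ⊆ (D k).Log := by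
  refine (D k).logicS4_subset_Log (fun w => D_rel_iff.2 (Or.inr rfl)) fun u v w huv hvw => ?_
  rcases D_rel_iff.1 hvw with h | rfl
  · exact D_rel_iff.2 (Or.inl h)
  · exact huv

theorem KripkeFrame.isTabular_Log_D (k : ℕ) : IsTabular (D k).Log :=
  ⟨(D k).isNormalLogic_Log, D k, inferInstanceAs (Finite (Fin (k + 1))), rfl⟩

/-! ### Truth in models on `D k`. -/

/-- Truth of a formula at a world of `D k`, where each world `w` makes exactly the variables in
`τ w` true. -/
def Sat {k : ℕ} (τ : Fin (k + 1) → Set PVar) (w : Fin (k + 1)) (φ : Fm) : Prop :=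
  w ∈ (KripkeFrame.D k).eval (fun p => {u : Fin (k + 1) | p ∈ τ u}) φ

section Sat

variable {k : ℕ} {τ : Fin (k + 1) → Set PVar} {w : Fin (k + 1)} {φ ψ : Fm} {p : PVar}

@[simp] theorem sat_lit_pos : Sat τ w (.lit (.pos p)) ↔ p ∈ τ w := Iff.rfl

@[simp] theorem sat_lit_neg : Sat τ w (.lit (.neg p)) ↔ p ∉ τ w := Iff.rfl

@[simp] theorem sat_var : Sat τ w (Fm.var p) ↔ p ∈ τ w := Iff.rfl

@[simp] theorem sat_bot : ¬ Sat τ w .bot := id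

@[simp] theorem sat_top : Sat τ w .top := trivial

@[simp] theorem sat_and : Sat τ w (.and φ ψ) ↔ Sat τ w φ ∧ Sat τ w ψ := Iff.rfl

@[simp] theorem sat_or : Sat τ w (.or φ ψ) ↔ Sat τ w φ ∨ Sat τ w ψ := Iff.rfl

@[simp] theorem sat_neg : Sat τ w φ.neg ↔ ¬ Sat τ w φ := by
  rw [Sat, KripkeFrame.eval_neg]
  rfl

@[simp] theorem sat_imp : Sat τ w (Fm.imp φ ψ) ↔ (Sat τ w φ → Sat τ w ψ) :=
  KripkeFrame.mem_eval_imp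

@[simp] theorem sat_iff : Sat τ w (Fm.iff φ ψ) ↔ (Sat τ w φ ↔ Sat τ w ψ) :=
  KripkeFrame.mem_eval_iff

theorem sat_dia :
    Sat τ w (.dia φ) ↔ ∃ u : Fin (k + 1), (u.val < k ∨ u = w) ∧ Sat τ u φ :=
  exists_congr fun _ => and_congr_left' KripkeFrame.D_rel_iff

theorem sat_box :
    Sat τ w (.box φ) ↔ ∀ u : Fin (k + 1), u.val < k ∨ u = w → Sat τ u φ :=
  forall_congr' fun _ => imp_congr_left KripkeFrame.D_rel_iff

/-- A cluster world sees only the cluster, and `hk` supplies one, namely `0`. Hence `□◇` and, below,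
`◇□` quantify over the cluster alone from any world, without negating anything. -/
theorem sat_box_dia (hk : 1 ≤ k) :
    Sat τ w (.box (.dia φ)) ↔ ∃ u : Fin (k + 1), u.val < k ∧ Sat τ u φ := by
  simp only [sat_box, sat_dia]
  constructor
  · intro h
    obtain ⟨u, hu, h'⟩ := h 0 (Or.inl hk)
    refine ⟨u, ?_, h'⟩
    rcases hu with hu | rfl
    exacts [hu, hk]
  · rintro ⟨u, hu, h⟩ v -
    exact ⟨u, Or.inl hu, h⟩

theorem sat_dia_box (hk : 1 ≤ k) :
    Sat τ w (.dia (.box φ)) ↔ ∀ u : Fin (k + 1), u.val < k → Sat τ u φ := by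
  simp only [sat_box, sat_dia]
  constructor
  · rintro ⟨v, -, h⟩ u hu
    exact h u (Or.inl hu)
  · intro h
    refine ⟨0, Or.inl hk, fun u hu => h u ?_⟩
    rcases hu with hu | rfl
    exacts [hu, hk]

theorem mem_Log_D : φ ∈ (KripkeFrame.D k).Log ↔
    ∀ (τ : Fin (k + 1) → Set PVar) (w : Fin (k + 1)), Sat τ w φ := by
  rw [KripkeFrame.mem_Log]
  exact ⟨fun h τ w => h _ w, fun h θ w => h (fun u => {p | u ∈ θ p}) w⟩

theorem sat_subst {σ : PVar → Fm} :
    Sat τ w (φ.subst σ) ↔ Sat (fun u => {p | Sat τ u (σ p)}) w φ := by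
  rw [Sat, KripkeFrame.eval_subst]
  rfl

end Sat

/-! ### Variables of formulas, finite conjunctions and disjunctions. -/

namespace Fm

theorem vars_lit_pos (p : PVar) : (lit (.pos p)).vars = {p} := by
  ext; simp [vars, lits]

theorem vars_lit_neg (p : PVar) : (lit (.neg p)).vars = {p} := by
  ext; simp [vars, lits]

theorem vars_and (φ ψ : Fm) : (and φ ψ).vars = φ.vars ∪ ψ.vars := by
  ext; simp only [vars, lits, Set.mem_union, Set.mem_ofPred_eq]; tauto

theorem vars_or (φ ψ : Fm) : (or φ ψ).vars = φ.vars ∪ ψ.vars := vars_and φ ψ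

theorem vars_neg (φ : Fm) : φ.neg.vars = φ.vars := by
  induction φ with
  | lit l => cases l <;> simp [neg, Literal.compl, vars_lit_pos, vars_lit_neg]
  | bot => simp [neg, vars, lits]
  | top => simp [neg, vars, lits]
  | and φ ψ h1 h2 => rw [neg, vars_or, vars_and, h1, h2]
  | or φ ψ h1 h2 => rw [neg, vars_and, vars_or, h1, h2]
  | dia φ h => exact h
  | box φ h => exact h

/-- The conjunction of a list of formulas. -/
def conj (l : List Fm) : Fm := l.foldr and top

/-- The disjunction of a list of formulas. -/
def disj (l : List Fm) : Fm := l.foldr or bot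

theorem mem_lits_conj {l : List Fm} {a : Literal} :
    a ∈ (conj l).lits ↔ ∃ φ ∈ l, a ∈ φ.lits := by
  induction l with
  | nil => simp [conj, lits]
  | cons φ l ih =>
    change a ∈ φ.lits ∪ (conj l).lits ↔ _
    simp [ih]

theorem mem_lits_disj {l : List Fm} {a : Literal} :
    a ∈ (disj l).lits ↔ ∃ φ ∈ l, a ∈ φ.lits := by
  induction l with
  | nil => simp [disj, lits]
  | cons φ l ih =>
    change a ∈ φ.lits ∪ (disj l).lits ↔ _
    simp [ih]

end Fm

theorem sat_conj {k : ℕ} {τ : Fin (k + 1) → Set PVar} {w : Fin (k + 1)} {l : List Fm} :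
    Sat τ w (Fm.conj l) ↔ ∀ φ ∈ l, Sat τ w φ := by
  induction l with
  | nil => simp [Fm.conj]
  | cons φ l ih =>
    change Sat τ w (.and φ (Fm.conj l)) ↔ _
    simp [ih]

theorem sat_disj {k : ℕ} {τ : Fin (k + 1) → Set PVar} {w : Fin (k + 1)} {l : List Fm} :
    Sat τ w (Fm.disj l) ↔ ∃ φ ∈ l, Sat τ w φ := by
  induction l with
  | nil => simp [Fm.disj]
  | cons φ l ih =>
    change Sat τ w (.or φ (Fm.disj l)) ↔ _
    simp [ih]

/-! ### Invariance under bisimulation and preservation of monotone formulas. -/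

/-- Two pointed models on `D k` agree on a formula if their points have the same type and their
clusters realize the same types. -/
theorem sat_congr {k : ℕ} {τ τ' : Fin (k + 1) → Set PVar} {V : Set PVar}
    (hf : ∀ u : Fin (k + 1), u.val < k →
      ∃ u' : Fin (k + 1), u'.val < k ∧ ∀ p ∈ V, p ∈ τ u ↔ p ∈ τ' u')
    (hb : ∀ u' : Fin (k + 1), u'.val < k →
      ∃ u : Fin (k + 1), u.val < k ∧ ∀ p ∈ V, p ∈ τ u ↔ p ∈ τ' u')
    {φ : Fm} (hφ : φ.vars ⊆ V) {w w' : Fin (k + 1)} (hw : ∀ p ∈ V, p ∈ τ w ↔ p ∈ τ' w') :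
    Sat τ w φ ↔ Sat τ' w' φ := by
  induction φ generalizing w w' with
  | lit l =>
    rcases l with p | p
    · exact hw p (hφ (by simp [Fm.vars_lit_pos]))
    · exact not_congr (hw p (hφ (by simp [Fm.vars_lit_neg])))
  | bot => exact Iff.rfl
  | top => exact Iff.rfl
  | and φ ψ h1 h2 =>
    rw [Fm.vars_and, Set.union_subset_iff] at hφ
    exact and_congr (h1 hφ.1 hw) (h2 hφ.2 hw)
  | or φ ψ h1 h2 =>
    rw [Fm.vars_or, Set.union_subset_iff] at hφ
    exact or_congr (h1 hφ.1 hw) (h2 hφ.2 hw)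
  | dia φ h =>
    rw [sat_dia, sat_dia]
    constructor
    · rintro ⟨u, hu | rfl, hs⟩
      · obtain ⟨u', hu', ht⟩ := hf u hu
        exact ⟨u', Or.inl hu', (h hφ ht).1 hs⟩
      · exact ⟨w', Or.inr rfl, (h hφ hw).1 hs⟩
    · rintro ⟨u, hu | rfl, hs⟩
      · obtain ⟨u', hu', ht⟩ := hb u hu
        exact ⟨u', Or.inl hu', (h hφ ht).2 hs⟩
      · exact ⟨w, Or.inr rfl, (h hφ hw).2 hs⟩
  | box φ h =>
    rw [sat_box, sat_box]
    constructor
    · rintro hs u (hu | rfl)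
      · obtain ⟨u', hu', ht⟩ := hb u hu
        exact (h hφ ht).1 (hs u' (Or.inl hu'))
      · exact (h hφ hw).1 (hs w (Or.inr rfl))
    · rintro hs u (hu | rfl)
      · obtain ⟨u', hu', ht⟩ := hf u hu
        exact (h hφ ht).2 (hs u' (Or.inl hu'))
      · exact (h hφ hw).2 (hs w' (Or.inr rfl))

/-- The order of types: more variables of `P` and the same variables of `R` are true. -/
def TypeLE (P R : Finset PVar) (s t : Set PVar) : Prop :=
  (∀ p ∈ P, p ∈ s → p ∈ t) ∧ ∀ r ∈ R, r ∈ s ↔ r ∈ t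

theorem TypeLE.refl (P R : Finset PVar) (s : Set PVar) : TypeLE P R s s :=
  ⟨fun _ _ h => h, fun _ _ => Iff.rfl⟩

/-- Truth of a formula that is monotone in the logic of `D k` is preserved when the types of
worlds are increased. -/
theorem IsMonotoneIn.sat_mono {k : ℕ} {P R : Finset PVar} {φ : Fm}
    (hm : IsMonotoneIn (KripkeFrame.D k).Log P R φ) (hφ : φ.vars ⊆ ↑(P ∪ R))
    {τ τ' : Fin (k + 1) → Set PVar} (hle : ∀ u, TypeLE P R (τ u) (τ' u)) {w : Fin (k + 1)}
    (hs : Sat τ w φ) : Sat τ' w φ := by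
  obtain ⟨q, hq, hfresh, hmem⟩ := hm
  -- One valuation carries both models: the variables themselves are read from `τ`, the fresh copies
  -- `q p` from `τ'`. Since `τ` lies below `τ'`, the substituted `p ∨ q p` then evaluates as in
  -- `τ'`.
  let ρ : Fin (k + 1) → Set PVar := fun u =>
    {v | (v ∈ P ∪ R ∧ v ∈ τ u) ∨ ∃ p ∈ P, q p = v ∧ p ∈ τ' u}
  have hρ : ∀ v ∈ P ∪ R, ∀ u, v ∈ ρ u ↔ v ∈ τ u := by
    intro v hv u
    constructor
    · rintro (⟨-, h⟩ | ⟨p, hp, rfl, -⟩)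
      · exact h
      · exact absurd hv (hfresh p hp)
    · exact fun h => Or.inl ⟨hv, h⟩
  have hρq : ∀ p ∈ P, ∀ u, q p ∈ ρ u ↔ p ∈ τ' u := by
    intro p hp u
    constructor
    · rintro (⟨h, -⟩ | ⟨p', hp', he, h⟩)
      · exact absurd h (hfresh p hp)
      · rwa [← hq hp' hp he]
    · exact fun h => Or.inr ⟨p, hp, rfl, h⟩
  have same : ∀ {τ₁ τ₂ : Fin (k + 1) → Set PVar}, (∀ u, ∀ v ∈ P ∪ R, v ∈ τ₁ u ↔ v ∈ τ₂ u) →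
      (Sat τ₁ w φ ↔ Sat τ₂ w φ) := fun h =>
    sat_congr (fun u hu => ⟨u, hu, fun v hv => h u v hv⟩)
      (fun u hu => ⟨u, hu, fun v hv => h u v hv⟩) hφ fun v hv => h w v hv
  have h1 : Sat ρ w φ := (same fun u v hv => hρ v hv u).2 hs
  have h2 := sat_subst.1 (sat_imp.1 (mem_Log_D.1 hmem ρ w) h1)
  refine (same fun u v hv => ?_).1 h2
  rw [Set.mem_ofPred_eq]
  split_ifs with hv'
  · rw [sat_or, sat_var, sat_var, hρ v hv, hρq v hv']
    exact ⟨fun h => h.elim ((hle u).1 v hv') id, Or.inr⟩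
  · rw [sat_var, hρ v hv]
    exact (hle u).2 v ((Finset.mem_union.1 hv).resolve_left hv')

/-- Interpolation of the Egli–Milner lifting of a relation: one can pass from `a` to `b` by first
increasing all values, then rearranging them and increasing all values again. -/
theorem exists_rearrangement {ι α : Type*} {r : α → α → Prop} (hr : ∀ x, r x x) {a b : ι → α}
    (hf : ∀ i, ∃ j, r (a i) (b j)) (hb : ∀ j, ∃ i, r (a i) (b j)) :
    ∃ c d : ι → α, (∀ i, r (a i) (c i)) ∧ (∀ i, ∃ j, c i = d j) ∧ (∀ j, ∃ i, c i = d j) ∧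
      ∀ j, r (d j) (b j) := by
  classical
  choose f hf using hf
  choose g hg using hb
  -- Indices in `S` are the chosen sources of those `j` that `f` misses. They keep the value `a i`
  -- in `c`; all others are raised to `b (f i)`. The last clause of `key` makes `d j = a (g j)` for
  -- missed `j`, so every value kept on `S` occurs in `d`.
  let S : Set ι := {i | ∃ j, (∀ i', f i' ≠ j) ∧ g j = i}
  have key : ∀ j, ∃ x, r x (b j) ∧ ((∃ i, (i ∉ S ∧ f i = j) ∧ x = b j) ∨
      ((∀ i, i ∉ S → f i ≠ j) ∧ ∃ i ∈ S, x = a i ∧ ((∀ i', f i' ≠ j) → i = g j))) := by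
    intro j
    by_cases h1 : ∃ i, i ∉ S ∧ f i = j
    · obtain ⟨i, h⟩ := h1
      exact ⟨b j, hr _, Or.inl ⟨i, h, rfl⟩⟩
    · have h1' : ∀ i, i ∉ S → f i ≠ j := fun i hi he => h1 ⟨i, hi, he⟩
      by_cases h2 : ∃ i, f i = j
      · obtain ⟨i, rfl⟩ := h2
        refine ⟨a i, hf i, Or.inr ⟨h1', i, ?_, rfl, fun h => absurd rfl (h i)⟩⟩
        by_contra hi
        exact h1' i hi rfl
      · have h2' : ∀ i, f i ≠ j := fun i he => h2 ⟨i, he⟩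
        exact ⟨a (g j), hg j, Or.inr ⟨h1', g j, ⟨j, h2', rfl⟩, rfl, fun _ => rfl⟩⟩
  choose d hd hd' using key
  refine ⟨fun i => if i ∈ S then a i else b (f i), d, fun i => ?_, fun i => ?_, fun j => ?_, hd⟩
  · dsimp only
    split_ifs
    exacts [hr _, hf i]
  · dsimp only
    split_ifs with hi
    · obtain ⟨j, hj, rfl⟩ := hi
      refine ⟨j, ?_⟩
      rcases hd' j with ⟨i, h, -⟩ | ⟨-, i, -, h, h'⟩
      · exact absurd h.2 (hj i)
      · rw [h, h' hj]
    · refine ⟨f i, ?_⟩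
      rcases hd' (f i) with ⟨i', -, h⟩ | ⟨h, -⟩
      · exact h.symm
      · exact absurd rfl (h i hi)
  · rcases hd' j with ⟨i, h, h'⟩ | ⟨-, i, hi, h, -⟩
    · exact ⟨i, by simp [h.1, h.2, h']⟩
    · exact ⟨i, by simp [hi, h]⟩

/-- Truth of a monotone formula is preserved along the positive simulation order. -/
theorem IsMonotoneIn.sat_transfer {k : ℕ} {P R : Finset PVar} {φ : Fm}
    (hm : IsMonotoneIn (KripkeFrame.D k).Log P R φ) (hφ : φ.vars ⊆ ↑(P ∪ R))
    {τ τ' : Fin (k + 1) → Set PVar} {w w' : Fin (k + 1)}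
    (hw : TypeLE P R (τ w) (τ' w'))
    (hf : ∀ u : Fin (k + 1), u.val < k →
      ∃ u' : Fin (k + 1), u'.val < k ∧ TypeLE P R (τ u) (τ' u'))
    (hb : ∀ u' : Fin (k + 1), u'.val < k →
      ∃ u : Fin (k + 1), u.val < k ∧ TypeLE P R (τ u) (τ' u'))
    (hs : Sat τ w φ) : Sat τ' w' φ := by
  obtain ⟨c, d, hac, hcd, hdc, hdb⟩ := exists_rearrangement (r := TypeLE P R) (TypeLE.refl P R)
    (a := fun i : Fin k => τ i.castSucc) (b := fun i : Fin k => τ' i.castSucc)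
    (fun i => by
      obtain ⟨u, hu, h⟩ := hf i.castSucc i.isLt
      exact ⟨⟨u, hu⟩, h⟩)
    (fun i => by
      obtain ⟨u, hu, h⟩ := hb i.castSucc i.isLt
      exact ⟨⟨u, hu⟩, h⟩)
  let M : (Fin k → Set PVar) → Set PVar → Fin (k + 1) → Set PVar := fun e s =>
    Fin.lastCases s e
  have hM : ∀ e s (i : Fin k), M e s i.castSucc = e i := fun e s i => Fin.lastCases_castSucc ..
  have hM' : ∀ e s, M e s (Fin.last k) = s := fun e s => Fin.lastCases_last ..
  have hcl : ∀ u : Fin (k + 1), u.val < k → ∃ i : Fin k, u = i.castSucc :=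
    fun u hu => ⟨⟨u, hu⟩, rfl⟩
  -- Copying the type of the evaluation point to the root lets it be raised independently of the
  -- cluster, even if the original point lay inside the cluster.
  have toRoot : ∀ (σ : Fin (k + 1) → Set PVar) (v : Fin (k + 1)),
      Sat σ v φ ↔ Sat (M (fun i => σ i.castSucc) (σ v)) (Fin.last k) φ := by
    intro σ v
    refine sat_congr (V := ↑(P ∪ R)) (fun u hu => ⟨u, hu, fun p _ => ?_⟩)
      (fun u hu => ⟨u, hu, fun p _ => ?_⟩) hφ fun p _ => by rw [hM']
    all_goals
      obtain ⟨i, rfl⟩ := hcl u hu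
      rw [hM]
  have step : ∀ {e e' : Fin k → Set PVar} {s s' : Set PVar}, (∀ i, TypeLE P R (e i) (e' i)) →
      TypeLE P R s s' → Sat (M e s) (Fin.last k) φ → Sat (M e' s') (Fin.last k) φ := by
    intro e e' s s' he hs' h
    refine hm.sat_mono hφ (fun u => ?_) h
    induction u using Fin.lastCases with
    | last => rwa [hM', hM']
    | cast i => rw [hM, hM]; exact he i
  refine (toRoot τ' w').2 (step hdb (TypeLE.refl P R _) ?_)
  refine (sat_congr (V := ↑(P ∪ R)) (fun u hu => ?_) (fun u hu => ?_) hφ fun p _ => ?_).1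
    (step hac hw ((toRoot τ w).1 hs))
  · obtain ⟨i, rfl⟩ := hcl u hu
    obtain ⟨j, hj⟩ := hcd i
    exact ⟨j.castSucc, j.isLt, fun p _ => by rw [hM, hM, hj]⟩
  · obtain ⟨i, rfl⟩ := hcl u hu
    obtain ⟨j, hj⟩ := hdc i
    exact ⟨j.castSucc, j.isLt, fun p _ => by rw [hM, hM, hj]⟩
  · rw [hM', hM']

/-! ### Positive descriptions of models and LPP. -/

open Classical in
/-- The formula expressing that the type of a world is at least `s`. -/
noncomputable def typeFm (P R s : Finset PVar) : Fm :=
  .and (Fm.conj ((P ∩ s).toList.map Fm.var))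
    (Fm.conj (R.toList.map fun r => if r ∈ s then Fm.var r else .lit (.neg r)))

theorem sat_typeFm {k : ℕ} {P R s : Finset PVar} {τ : Fin (k + 1) → Set PVar} {w : Fin (k + 1)} :
    Sat τ w (typeFm P R s) ↔ TypeLE P R ↑s (τ w) := by
  simp only [typeFm, sat_and, sat_conj, List.forall_mem_map, Finset.mem_toList, sat_var,
    Finset.mem_inter, TypeLE, Finset.mem_coe, and_imp]
  refine and_congr Iff.rfl (forall₂_congr fun r _ => ?_)
  split_ifs with h <;> simp [h]

theorem lits_typeFm {P R s : Finset PVar} {l : Literal} (hl : l ∈ (typeFm P R s).lits) :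
    (∃ p ∈ P, l = .pos p) ∨ ∃ r ∈ R, l = .pos r ∨ l = .neg r := by
  rcases hl with hl | hl <;> rw [Fm.mem_lits_conj] at hl <;>
    obtain ⟨φ, hφ, hl⟩ := hl <;> obtain ⟨p, hp, rfl⟩ := List.mem_map.1 hφ
  · exact Or.inl ⟨p, (Finset.mem_inter.1 (Finset.mem_toList.1 hp)).1, hl⟩
  · refine Or.inr ⟨p, Finset.mem_toList.1 hp, ?_⟩
    split_ifs at hl
    exacts [Or.inl hl, Or.inr hl]

/-- The formula expressing that a pointed model is above one whose point has type `s` and whose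
cluster realizes the types in `A`. -/
noncomputable def modelFm (P R s : Finset PVar) (A : Finset (Finset PVar)) : Fm :=
  .and (typeFm P R s)
    (.and (Fm.conj (A.toList.map fun a => .box (.dia (typeFm P R a))))
      (.dia (.box (Fm.disj (A.toList.map (typeFm P R))))))

theorem sat_modelFm {k : ℕ} (hk : 1 ≤ k) {P R s : Finset PVar} {A : Finset (Finset PVar)}
    {τ : Fin (k + 1) → Set PVar} {w : Fin (k + 1)} :
    Sat τ w (modelFm P R s A) ↔ TypeLE P R ↑s (τ w) ∧
      (∀ a ∈ A, ∃ u : Fin (k + 1), u.val < k ∧ TypeLE P R ↑a (τ u)) ∧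
      ∀ u : Fin (k + 1), u.val < k → ∃ a ∈ A, TypeLE P R ↑a (τ u) := by
  simp [modelFm, sat_conj, sat_disj, sat_box_dia hk, sat_dia_box hk, sat_typeFm]

theorem lits_modelFm {P R s : Finset PVar} {A : Finset (Finset PVar)} {l : Literal}
    (hl : l ∈ (modelFm P R s A).lits) :
    (∃ p ∈ P, l = .pos p) ∨ ∃ r ∈ R, l = .pos r ∨ l = .neg r := by
  rcases hl with hl | hl | hl
  · exact lits_typeFm hl
  · obtain ⟨φ, hφ, hl⟩ := Fm.mem_lits_conj.1 hl
    obtain ⟨a, -, rfl⟩ := List.mem_map.1 hφ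
    exact lits_typeFm hl
  · obtain ⟨φ, hφ, hl⟩ := Fm.mem_lits_disj.1 hl
    obtain ⟨a, -, rfl⟩ := List.mem_map.1 hφ
    exact lits_typeFm hl

open Classical in
theorem hasLPP_Log_D {k : ℕ} (hk : 1 ≤ k) : HasLPP (KripkeFrame.D k).Log := by
  refine ⟨KripkeFrame.isMonotoneLogic_Log _, fun P R hPR φ hφ hm => ?_⟩
  -- Types are cut down to `P ∪ R`, so that only finitely many pairs of a point type and a set of
  -- cluster types can arise from models of `φ`; `L` collects them.
  let ty : Set PVar → Finset PVar := fun s => (P ∪ R).filter (· ∈ s)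
  have hty : ∀ s, ∀ p ∈ P ∪ R, p ∈ ty s ↔ p ∈ s := fun s p hp => by simp [ty, Finset.mem_union.1 hp]
  have hle : ∀ s t, TypeLE P R ↑(ty s) t ↔ TypeLE P R s t := fun s t =>
    and_congr
      (forall₂_congr fun p hp => by rw [Finset.mem_coe, hty s p (Finset.mem_union_left _ hp)])
      (forall₂_congr fun p hp => by rw [Finset.mem_coe, hty s p (Finset.mem_union_right _ hp)])
  let cl : (Fin (k + 1) → Set PVar) → Finset (Finset PVar) := fun τ =>
    (Finset.univ.filter fun u : Fin (k + 1) => u.val < k).image fun u => ty (τ u)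
  let L : Finset (Finset PVar × Finset (Finset PVar)) :=
    ((P ∪ R).powerset ×ˢ (P ∪ R).powerset.powerset).filter fun x =>
      ∃ (τ : Fin (k + 1) → Set PVar) (w : Fin (k + 1)), Sat τ w φ ∧ x = (ty (τ w), cl τ)
  have hlits : ∀ l ∈ (Fm.disj (L.toList.map fun x => modelFm P R x.1 x.2)).lits,
      (∃ p ∈ P, l = .pos p) ∨ ∃ r ∈ R, l = .pos r ∨ l = .neg r := by
    intro l hl
    obtain ⟨ψ, hψ, hl⟩ := Fm.mem_lits_disj.1 hl
    obtain ⟨x, -, rfl⟩ := List.mem_map.1 hψ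
    exact lits_modelFm hl
  refine ⟨Fm.disj (L.toList.map fun x => modelFm P R x.1 x.2), ?_, ?_, ?_⟩
  · intro v hv
    rw [Finset.mem_coe, Finset.mem_union]
    rcases hv with hv | hv <;> rcases hlits _ hv with ⟨p, hp, h⟩ | ⟨r, hr, h | h⟩ <;> cases h
    exacts [Or.inl hp, Or.inr hr, Or.inr hr]
  · intro p hp hl
    rcases hlits _ hl with ⟨p', -, h⟩ | ⟨r, hr, h | h⟩ <;> cases h
    exact Finset.disjoint_left.1 hPR hp hr
  · refine mem_Log_D.2 fun τ' w' => sat_iff.2 ?_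
    rw [sat_disj]
    constructor
    · intro hs
      refine ⟨_, List.mem_map.2 ⟨(ty (τ' w'), cl τ'), ?_, rfl⟩, ?_⟩
      · rw [Finset.mem_toList, Finset.mem_filter, Finset.mem_product, Finset.mem_powerset,
          Finset.mem_powerset]
        refine ⟨⟨Finset.filter_subset _ _, fun a ha => ?_⟩, τ', w', hs, rfl⟩
        obtain ⟨u, -, rfl⟩ := Finset.mem_image.1 ha
        exact Finset.mem_powerset.2 (Finset.filter_subset _ _)
      · rw [sat_modelFm hk]
        refine ⟨(hle _ _).2 (TypeLE.refl ..), fun a ha => ?_, fun u hu => ?_⟩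
        · obtain ⟨u, hu, rfl⟩ := Finset.mem_image.1 ha
          exact ⟨u, (Finset.mem_filter.1 hu).2, (hle _ _).2 (TypeLE.refl ..)⟩
        · exact ⟨ty (τ' u), Finset.mem_image_of_mem _ (Finset.mem_filter.2 ⟨Finset.mem_univ _, hu⟩),
            (hle _ _).2 (TypeLE.refl ..)⟩
    · rintro ⟨ψ, hψ, h⟩
      obtain ⟨x, hx, rfl⟩ := List.mem_map.1 hψ
      obtain ⟨-, τ, w, hs, rfl⟩ := Finset.mem_filter.1 (Finset.mem_toList.1 hx)
      obtain ⟨h1, h2, h3⟩ := (sat_modelFm hk).1 h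
      -- The disjunct says precisely that the present pointed model lies above a recorded model of
      -- `φ`.
      refine hm.sat_transfer hφ ((hle _ _).1 h1) (fun u hu => ?_) (fun u hu => ?_) hs
      · obtain ⟨u', hu', h'⟩ := h2 (ty (τ u))
          (Finset.mem_image_of_mem _ (Finset.mem_filter.2 ⟨Finset.mem_univ _, hu⟩))
        exact ⟨u', hu', (hle _ _).1 h'⟩
      · obtain ⟨a, ha, h'⟩ := h3 u hu
        obtain ⟨u', hu', rfl⟩ := Finset.mem_image.1 ha
        exact ⟨u', (Finset.mem_filter.1 hu').2, (hle _ _).1 h'⟩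

/-! ### Counting cluster worlds: distinct logics and failure of interpolation. -/

/-- The formula expressing that, for each `i < n`, some world of the cluster satisfies `β`, the
variable `v i` and no variable `v j` with `j < i`. -/
def countFm (β : Fm) (v : ℕ → PVar) (n : ℕ) : Fm :=
  Fm.conj ((List.range n).map fun i => .box (.dia (.and β (.and (Fm.var (v i))
    (Fm.conj ((List.range i).map fun j => .lit (.neg (v j))))))))

theorem sat_countFm {k : ℕ} (hk : 1 ≤ k) {β : Fm} {v : ℕ → PVar} {n : ℕ}
    {τ : Fin (k + 1) → Set PVar} {w : Fin (k + 1)} :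
    Sat τ w (countFm β v n) ↔ ∀ i < n, ∃ u : Fin (k + 1), u.val < k ∧ Sat τ u β ∧ v i ∈ τ u ∧
      ∀ j < i, v j ∉ τ u := by
  simp [countFm, sat_conj, sat_box_dia hk]

theorem vars_countFm {β : Fm} {v : ℕ → PVar} {n : ℕ} :
    (countFm β v n).vars ⊆ β.vars ∪ Set.range v := by
  have key : ∀ l ∈ (countFm β v n).lits, l ∈ β.lits ∨ ∃ i, l = .pos (v i) ∨ l = .neg (v i) := by
    intro l hl
    obtain ⟨φ, hφ, hl⟩ := Fm.mem_lits_conj.1 hl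
    obtain ⟨i, -, rfl⟩ := List.mem_map.1 hφ
    rcases hl with hl | hl | hl
    · exact Or.inl hl
    · exact Or.inr ⟨i, Or.inl hl⟩
    · obtain ⟨ψ, hψ, hl⟩ := Fm.mem_lits_conj.1 hl
      obtain ⟨j, -, rfl⟩ := List.mem_map.1 hψ
      exact Or.inr ⟨j, Or.inr hl⟩
  rintro p (hp | hp) <;> rcases key _ hp with h | ⟨i, h | h⟩
  · exact Or.inl (Or.inl h)
  · cases h; exact Or.inr ⟨i, rfl⟩
  · cases h
  · exact Or.inl (Or.inr h)
  · cases h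
  · cases h; exact Or.inr ⟨i, rfl⟩

open Classical in
-- At the `i`-th witness, `i` is the least index whose variable is true; hence the witnesses are
-- distinct.
theorem le_card_of_sat_countFm {k : ℕ} (hk : 1 ≤ k) {β : Fm} {v : ℕ → PVar} {n : ℕ}
    {τ : Fin (k + 1) → Set PVar} {w : Fin (k + 1)} (h : Sat τ w (countFm β v n)) :
    n ≤ (Finset.univ.filter fun i : Fin k => Sat τ i.castSucc β).card := by
  rw [sat_countFm hk] at h
  choose f hf hβ hv hn using h
  let g : Fin n → Fin k := fun i => ⟨f i i.isLt, hf i i.isLt⟩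
  have hg : Function.Injective g := by
    intro i j hij
    have hij' : f i i.isLt = f j j.isLt := Fin.ext (Fin.mk.inj hij)
    rcases lt_trichotomy i j with hlt | heq | hlt
    · exact absurd (hv i i.isLt) (hij' ▸ hn j j.isLt i hlt)
    · exact heq
    · exact absurd (hv j j.isLt) (hij' ▸ hn i i.isLt j hlt)
  calc n = (Finset.univ.image g).card := by rw [Finset.card_image_of_injective _ hg]; simp
    _ ≤ _ := by
      refine Finset.card_le_card fun x hx => ?_
      obtain ⟨i, -, rfl⟩ := Finset.mem_image.1 hx
      exact Finset.mem_filter.2 ⟨Finset.mem_univ _, hβ i i.isLt⟩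

theorem neg_countFm_top_mem_Log_D {k n : ℕ} (hk : 1 ≤ k) :
    (countFm .top id n).neg ∈ (KripkeFrame.D k).Log ↔ k < n := by
  classical
  rw [mem_Log_D]
  constructor
  · intro h
    by_contra hn
    refine sat_neg.1 (h (fun u => {u.val}) 0) ((sat_countFm hk).2 fun i hi => ?_)
    refine ⟨⟨i, by omega⟩, by simp only; omega, sat_top, rfl, fun j hj he => ?_⟩
    exact absurd (show j = i from he) hj.ne
  · intro hn τ w
    rw [sat_neg]
    intro h
    have h1 := (le_card_of_sat_countFm hk h).trans (Finset.card_le_univ _)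
    rw [Fintype.card_fin] at h1
    omega

/-- The size of the cluster is the largest `n` for which `countFm .top id n` is satisfiable. The
shift by 3 restricts to the frames where CIP is refuted. -/
theorem Log_D_injective : Function.Injective fun m : ℕ => (KripkeFrame.D (m + 3)).Log := by
  intro m n h
  have key : ∀ l, m + 3 < l ↔ n + 3 < l := fun l => by
    rw [← neg_countFm_top_mem_Log_D (Nat.le_add_left 1 (m + 2)),
      ← neg_countFm_top_mem_Log_D (Nat.le_add_left 1 (n + 2))]
    exact Set.ext_iff.1 h _
  have h1 := key (m + 4)
  have h2 := key (n + 4)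
  omega

theorem HasLIP.hasCIP {Λ : Set Fm} (h : HasLIP Λ) : HasCIP Λ := by
  intro φ ψ hφψ
  obtain ⟨ι, hι, h1, h2⟩ := h φ ψ hφψ
  refine ⟨ι, ?_, h1, h2⟩
  rintro p (hp | hp)
  exacts [⟨Or.inl (hι hp).1, Or.inl (hι hp).2⟩, ⟨Or.inr (hι hp).1, Or.inr (hι hp).2⟩]

theorem not_hasCIP_Log_D {k : ℕ} (hk : 3 ≤ k) : ¬ HasCIP (KripkeFrame.D k).Log := by
  classical
  have hk1 : 1 ≤ k := by omega
  intro h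
  -- Odd and positive even variables keep the two counts apart, so only variable `0` is shared. Both
  -- counts together would need `2 * (k - 1) ≤ k`, impossible for `k ≥ 3`.
  obtain ⟨ι, hι, h1, h2⟩ := h (countFm (.lit (.neg 0)) (fun i => 2 * i + 1) (k - 1))
    (countFm (.lit (.pos 0)) (fun i => 2 * i + 2) (k - 1)).neg (by
      refine mem_Log_D.2 fun τ w => sat_imp.2 fun h => sat_neg.2 fun h' => ?_
      have c1 := le_card_of_sat_countFm hk1 h
      have c2 := le_card_of_sat_countFm hk1 h'
      simp only [sat_lit_pos, sat_lit_neg] at c1 c2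
      have c3 := Finset.card_filter_add_card_filter_not (s := (Finset.univ : Finset (Fin k)))
        (fun i => (0 : PVar) ∈ τ i.castSucc)
      rw [Finset.card_univ, Fintype.card_fin] at c3
      omega)
  have hι0 : ι.vars ⊆ {0} := by
    intro p hp
    have hp1 := vars_countFm (hι hp).1
    have hp2 := vars_countFm ((Fm.vars_neg _).subset (hι hp).2)
    rw [Fm.vars_lit_neg] at hp1
    rw [Fm.vars_lit_pos] at hp2
    rcases hp1 with hp1 | ⟨i, rfl⟩
    · exact hp1
    · rcases hp2 with hp2 | ⟨j, hj⟩
      · exact hp2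
      · exact absurd (show 2 * j + 2 = 2 * i + 1 from hj) (by omega)
  -- Variable `0` fails at `k - 1` cluster worlds in `τ₁` and holds at `k - 1` of them in `τ₂`;
  -- cluster world `k - 1` is the exception in each. Both clusters thus realize both values, and the
  -- evaluation points `0` and `k - 1` both falsify it, so `ι` cannot tell the pointed models apart.
  let τ₁ : Fin (k + 1) → Set PVar := fun u => if u.val < k - 1 then {2 * u.val + 1} else {0}
  let τ₂ : Fin (k + 1) → Set PVar := fun u => if u.val < k - 1 then {0, 2 * u.val + 2} else ∅
  have s1 : Sat τ₁ 0 (countFm (.lit (.neg 0)) (fun i => 2 * i + 1) (k - 1)) := by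
    refine (sat_countFm hk1).2 fun i hi => ⟨⟨i, by omega⟩, by simp only; omega, ?_⟩
    simp only [sat_lit_neg, τ₁, if_pos hi, Set.mem_singleton_iff]
    exact ⟨Nat.succ_ne_zero _ ∘ Eq.symm, trivial, fun j hj he =>
      absurd (show 2 * j + 1 = 2 * i + 1 from he) (by omega)⟩
  have s2 : Sat τ₂ ⟨k - 1, by omega⟩ (countFm (.lit (.pos 0)) (fun i => 2 * i + 2) (k - 1)) := by
    refine (sat_countFm hk1).2 fun i hi => ⟨⟨i, by omega⟩, by simp only; omega, ?_⟩
    simp only [sat_lit_pos, τ₂, if_pos hi, Set.mem_singleton_iff, Set.mem_insert_iff]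
    exact ⟨Or.inl trivial, Or.inr trivial, fun j hj he =>
      he.elim (Nat.succ_ne_zero _) fun he =>
        absurd (show 2 * j + 2 = 2 * i + 2 from he) (by omega)⟩
  have t1 : ∀ u, (0 : PVar) ∈ τ₁ u ↔ ¬ u.val < k - 1 := by
    intro u
    by_cases hu : u.val < k - 1 <;> simp [τ₁, hu]
  have t2 : ∀ u, (0 : PVar) ∈ τ₂ u ↔ u.val < k - 1 := by
    intro u
    by_cases hu : u.val < k - 1 <;> simp [τ₂, hu]
  have hsim : ∀ u : Fin (k + 1), ∃ u' : Fin (k + 1), u'.val < k ∧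
      (u.val < k - 1 ↔ ¬ u'.val < k - 1) := by
    intro u
    by_cases hu : u.val < k - 1
    · exact ⟨⟨k - 1, by omega⟩, by simp only; omega, by simp only; omega⟩
    · exact ⟨0, hk1, by rw [Fin.val_zero]; omega⟩
  refine sat_neg.1 (sat_imp.1 (mem_Log_D.1 h2 τ₂ _) ?_) s2
  refine (sat_congr (fun u _ => ?_) (fun u _ => ?_) hι0 ?_).1
    (sat_imp.1 (mem_Log_D.1 h1 τ₁ 0) s1)
  · obtain ⟨u', hu', h'⟩ := hsim u
    refine ⟨u', hu', fun p hp => ?_⟩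
    rw [Set.mem_singleton_iff.1 hp, t1, t2]
    tauto
  · obtain ⟨u', hu', h'⟩ := hsim u
    refine ⟨u', hu', fun p hp => ?_⟩
    rw [Set.mem_singleton_iff.1 hp, t1, t2]
    tauto
  · intro p hp
    rw [Set.mem_singleton_iff.1 hp, t1, t2, Fin.val_zero]
    simp only
    omega

theorem mainTheorem6 :
    (∀ k : ℕ, 1 ≤ k →
      IsTabular (KripkeFrame.D k).Log ∧ logicS4 ⊆ (KripkeFrame.D k).Log ∧
        HasLPP (KripkeFrame.D k).Log) ∧
    {Λ : Set Fm | IsTabular Λ ∧ logicS4 ⊆ Λ ∧ ¬ HasCIP Λ ∧ ¬ HasLIP Λ ∧ HasLPP Λ}.Infinite := by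
  refine ⟨fun k hk => ⟨KripkeFrame.isTabular_Log_D k, KripkeFrame.logicS4_subset_Log_D k,
    hasLPP_Log_D hk⟩, Set.infinite_of_injective_forall_mem Log_D_injective fun m => ?_⟩
  have hC : ¬ HasCIP (KripkeFrame.D (m + 3)).Log := not_hasCIP_Log_D (Nat.le_add_left 3 m)
  exact ⟨KripkeFrame.isTabular_Log_D _, KripkeFrame.logicS4_subset_Log_D _, hC,
    fun h => hC h.hasCIP, hasLPP_Log_D (Nat.le_add_left 1 (m + 2))⟩
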